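/- Let $(B,\Sigma,\mu)$ be a probability space and let $\mathcal{B}\subseteq\Sigma$ be a countable family of measurable sets (the test sets). The VC-dimension $d_{\mathcal{B}}$ of $\mathcal{B}$ is the largest cardinality of a set $P\subseteq B$ such that $\{P\cap T : T\in\mathcal{B}\}$ contains all subsets of $P$; assume that it is finite and $d_{\mathcal{B}}\ge 1$. For $\mathcal{P}\subseteq B$ define the $(\mathcal{B},\mu)$-dispersion $$\mathrm{disp}_\mu(\mathcal{P};\mathcal{B}) := \sup\{\mu(T) : T\in\mathcal{B},\ T\cap\mathcal{P}=\emptyset\},$$ with $\sup\emptyset := 0$. Let $n\in\mathbb{N}$ with $n\ge d_{\mathcal{B}}$, let $X_1,\dots,X_n$ be independent $B$-valued random variables on a probability space $(\Omega,\mathcal{A},\mathbb{P})$, each with distribution $\mu$, and put $\mathcal{P}_n:=\{X_1,\dots,X_n\}$. Then $\mathrm{disp}_\mu(\mathcal{P}_n;\mathcal{B})$ is integrable and $$\mathbb{E}\big[\mathrm{disp}_\mu(\mathcal{P}_n;\mathcal{B})\big]\le \frac{4d_{\mathcal{B}}}{n}\,\log_2\!\left(\frac{e\,n}{d_{\mathcal{B}}}\right).$$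 -/

import Mathlib

open MeasureTheory ProbabilityTheory

/-- `𝓑` shatters `P` if every subset of `P` is the intersection of `P` with a member of `𝓑`. -/
def SetShatters {B : Type*} (𝓑 : Set (Set B)) (P : Set B) : Prop :=
  ∀ S ⊆ P, ∃ T ∈ 𝓑, P ∩ T = S

/-- The Vapnik–Chervonenkis dimension of a family of sets: the largest cardinality of a shattered
set (`⊤` if shattered sets can be arbitrarily large). -/
noncomputable def setVCDim {B : Type*} (𝓑 : Set (Set B)) : ℕ∞ :=
  ⨆ P ∈ {P : Set B | SetShatters 𝓑 P}, P.encard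

/-- The `(𝓑, μ)`-dispersion of a point set `P`: the supremum of the measures of the test sets that
contain no point of `P` (it is `0` if there are no such test sets). -/
noncomputable def dispersion {B : Type*} [MeasurableSpace B] (μ : Measure B) (𝓑 : Set (Set B))
    (P : Set B) : ℝ :=
  sSup {r : ℝ | ∃ T ∈ 𝓑, T ∩ P = ∅ ∧ r = μ.real T}

open scoped ENNReal

/-! For a test set `T` missing the sample, an independent second sample `y` satisfies `E 2 ^ #{i | y
i ∈ T} = (1 + μ T) ^ n ≥ 2 ^ (n * μ T)`. The integrand depends only on the trace of `T` on the
double sample, so summing the weights of all traces handles every `T` at once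
(`two_rpow_dispersion_le`). Swapping the points of each pair by fair coins preserves the law and
makes each fixed trace weigh at most 1 on average. Hence the mean sum is at most the maximal number
of traces (`lintegral_ghostSum_le`), which Sauer–Shelah bounds by a binomial sum (`card_traces_le`).
Jensen turns the resulting bound on `E 2 ^ (n * disp)` into one on the mean dispersion. -/

/-! ### Binomial sums -/

lemma sum_choose_le_exp_mul_div_pow {N d : ℕ} (hd : 1 ≤ d) (hdN : d ≤ N) :
    ((∑ k ∈ Finset.Iic d, N.choose k : ℕ) : ℝ) ≤ (Real.exp 1 * N / d) ^ d := by
  have hd0 : (0 : ℝ) < d := by exact_mod_cast hd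
  have hN0 : (0 : ℝ) < N := by exact_mod_cast lt_of_lt_of_le hd hdN
  have hq0 : (0 : ℝ) < d / N := by positivity
  have hq1 : (d : ℝ) / N ≤ 1 := (div_le_one hN0).2 (by exact_mod_cast hdN)
  -- As `d / N ≤ 1`, replacing the factor `(d / N) ^ d` by `(d / N) ^ k` only increases the `k`-th
  -- term, and leaves part of a binomial expansion.
  have key : ((∑ k ∈ Finset.Iic d, N.choose k : ℕ) : ℝ) * ((d : ℝ) / N) ^ d ≤ Real.exp 1 ^ d := by
    calc ((∑ k ∈ Finset.Iic d, N.choose k : ℕ) : ℝ) * ((d : ℝ) / N) ^ d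
        = ∑ k ∈ Finset.Iic d, (N.choose k : ℝ) * ((d : ℝ) / N) ^ d := by
          push_cast; rw [Finset.sum_mul]
      _ ≤ ∑ k ∈ Finset.Iic d, (N.choose k : ℝ) * ((d : ℝ) / N) ^ k := by
          refine Finset.sum_le_sum fun k hk => ?_
          gcongr ?_ * ?_
          exact pow_le_pow_of_le_one hq0.le hq1 (Finset.mem_Iic.1 hk)
      _ ≤ ∑ k ∈ Finset.range (N + 1), (N.choose k : ℝ) * ((d : ℝ) / N) ^ k := by
          refine Finset.sum_le_sum_of_subset_of_nonneg (fun k hk => ?_) fun _ _ _ => by positivity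
          have := Finset.mem_Iic.1 hk
          exact Finset.mem_range.2 (by omega)
      _ = ((d : ℝ) / N + 1) ^ N := by
          rw [add_pow]
          exact Finset.sum_congr rfl fun k _ => by simp [mul_comm]
      _ ≤ Real.exp ((d : ℝ) / N) ^ N := by
          gcongr
          exact Real.add_one_le_exp _
      _ = Real.exp 1 ^ d := by
          rw [← Real.exp_nat_mul, ← Real.exp_nat_mul]
          congr 1
          field_simp
  have : (Real.exp 1 * N / d) ^ d = Real.exp 1 ^ d / ((d : ℝ) / N) ^ d := by
    rw [← div_pow]
    congr 1
    field_simp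
  rw [this, le_div_iff₀ (by positivity)]
  exact key

/-! ### Traces, Sauer–Shelah and swaps -/

section Traces

variable {B κ ι : Type*}

open Classical in
/-- The index sets cut out of a finite sequence of points by the members of a family of sets. -/
noncomputable def traces [Fintype κ] (𝓑 : Set (Set B)) (z : κ → B) : Finset (Finset κ) :=
  {S | ∃ T ∈ 𝓑, ∀ i, i ∈ S ↔ z i ∈ T}

lemma mem_traces [Fintype κ] {𝓑 : Set (Set B)} {z : κ → B} {S : Finset κ} :
    S ∈ traces 𝓑 z ↔ ∃ T ∈ 𝓑, ∀ i, i ∈ S ↔ z i ∈ T := by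
  simp [traces]

/-- An index set shattered by the traces indexes distinct points, which are shattered. -/
lemma card_le_of_shatters_traces [Fintype κ] [DecidableEq κ] {𝓑 : Set (Set B)} {d : ℕ}
    (hd : setVCDim 𝓑 ≤ d) {z : κ → B} {J : Finset κ} (hJ : (traces 𝓑 z).Shatters J) : J.card ≤ d := by
  have hinj : Set.InjOn z J := by
    intro i hi j hj hij
    obtain ⟨S, hS, hSi⟩ := hJ (Finset.singleton_subset_iff.2 hi)
    obtain ⟨T, -, hT⟩ := mem_traces.1 hS
    have hiS : i ∈ S := (Finset.mem_inter.1 (hSi ▸ Finset.mem_singleton_self i)).2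
    have hjS : j ∈ S := (hT j).2 (hij ▸ (hT i).1 hiS)
    have : j ∈ ({i} : Finset κ) := hSi ▸ Finset.mem_inter.2 ⟨hj, hjS⟩
    exact (Finset.mem_singleton.1 this).symm
  have hsh : SetShatters 𝓑 (Set.image z J) := by
    classical
    intro Q hQ
    obtain ⟨S, hS, hSi⟩ := hJ (Finset.filter_subset (fun i => z i ∈ Q) J)
    obtain ⟨T, hT𝓑, hT⟩ := mem_traces.1 hS
    refine ⟨T, hT𝓑, ?_⟩
    have hmem : ∀ i ∈ J, (z i ∈ T ↔ z i ∈ Q) := by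
      intro i hi
      have := Finset.ext_iff.1 hSi i
      simp only [Finset.mem_inter, Finset.mem_filter, hi, true_and] at this
      rw [← hT, this]
    ext b
    constructor
    · rintro ⟨⟨i, hi, rfl⟩, hb⟩
      exact (hmem i hi).1 hb
    · intro hb
      obtain ⟨i, hi, rfl⟩ := hQ hb
      exact ⟨⟨i, hi, rfl⟩, (hmem i hi).2 hb⟩
  have h1 : (Set.image z J).encard ≤ setVCDim 𝓑 :=
    le_iSup₂ (f := fun (P : Set B) (_ : P ∈ {P : Set B | SetShatters 𝓑 P}) => P.encard) _ hsh
  rw [hinj.encard_image, Set.encard_coe_eq_coe_finsetCard] at h1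
  exact_mod_cast h1.trans hd

/-- The **Sauer–Shelah lemma** for the traces of a family on a sequence of points. -/
lemma card_traces_le [Fintype κ] [DecidableEq κ] {𝓑 : Set (Set B)} {d : ℕ}
    (hd : setVCDim 𝓑 ≤ d) (z : κ → B) :
    (traces 𝓑 z).card ≤ ∑ k ∈ Finset.Iic d, (Fintype.card κ).choose k := by
  refine (Finset.card_le_card_shatterer _).trans
    (Finset.card_shatterer_le_sum_vcDim.trans (Finset.sum_le_sum_of_subset ?_))
  refine Finset.Iic_subset_Iic.2 (Finset.sup_le fun J hJ => ?_)
  exact card_le_of_shatters_traces hd (Finset.mem_shatterer.1 hJ)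

/-- The weight `2 ^ #S` if `S` contains only indices of the second sample, and `0` otherwise. -/
noncomputable def ghostWeight [Fintype ι] [DecidableEq ι] (S : Finset (ι × Bool)) : ℝ≥0∞ :=
  ∏ i, ((if (i, false) ∈ S then 0 else 1) * (if (i, true) ∈ S then 2 else 1))

/-- The permutation exchanging the indices `(i, false)` and `(i, true)` whenever `s i` is true. -/
def pairSwap (s : ι → Bool) : Equiv.Perm (ι × Bool) where
  toFun q := (q.1, s q.1 ^^ q.2)
  invFun q := (q.1, s q.1 ^^ q.2)
  left_inv q := by simp
  right_inv q := by simp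

lemma mem_finsetCongr_pairSwap (s : ι → Bool) (S : Finset (ι × Bool)) (q : ι × Bool) :
    q ∈ (pairSwap s).finsetCongr S ↔ pairSwap s q ∈ S := by
  rw [Equiv.finsetCongr_apply, Finset.mem_map_equiv]
  rfl

/-- The swaps act independently on the pairs, so the sum factors over `i`. A pair contributes `1 +
1`, `0 + 2` or `0 + 0` according as none, one or both of its indices lie in `S`: never more than 2.
-/
lemma sum_ghostWeight_pairSwap_le [Fintype ι] [DecidableEq ι] (S : Finset (ι × Bool)) :
    ∑ s : ι → Bool, ghostWeight ((pairSwap s).finsetCongr S) ≤ 2 ^ Fintype.card ι := by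
  have h : ∀ s : ι → Bool, ghostWeight ((pairSwap s).finsetCongr S) =
      ∏ i, ((if (i, s i) ∈ S then (0 : ℝ≥0∞) else 1) * (if (i, !s i) ∈ S then 2 else 1)) := by
    intro s
    simp only [ghostWeight, mem_finsetCongr_pairSwap]
    simp [pairSwap]
  simp_rw [h]
  have h2 := Finset.prod_univ_sum (fun _ : ι => (Finset.univ : Finset Bool))
    (fun i c => (if (i, c) ∈ S then (0 : ℝ≥0∞) else 1) * (if (i, !c) ∈ S then 2 else 1))
  rw [Fintype.piFinset_univ] at h2
  rw [← h2, ← Finset.card_univ, ← Finset.prod_const]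
  refine Finset.prod_le_prod' fun i _ => ?_
  by_cases h0 : (i, false) ∈ S <;> by_cases h1 : (i, true) ∈ S <;> simp [h0, h1, one_add_one_eq_two]

lemma mem_traces_comp_pairSwap [Fintype ι] {𝓑 : Set (Set B)} {z : ι × Bool → B}
    (s : ι → Bool) {S : Finset (ι × Bool)} :
    S ∈ traces 𝓑 (z ∘ pairSwap s) ↔ (pairSwap s).finsetCongr S ∈ traces 𝓑 z := by
  simp only [mem_traces, mem_finsetCongr_pairSwap]
  refine exists_congr fun T => and_congr_right fun _ => ?_
  rw [← (pairSwap s).forall_congr_right]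
  refine forall_congr' fun q => ?_
  have : pairSwap s (pairSwap s q) = q := (pairSwap s).left_inv q
  simp [this]

/-- Swapping points only relabels the traces, so the swaps can be summed for one fixed trace at a
time. -/
lemma sum_ghostWeight_traces_pairSwap_le [Fintype ι] [DecidableEq ι] (𝓑 : Set (Set B))
    (z : ι × Bool → B) :
    ∑ s : ι → Bool, ∑ S ∈ traces 𝓑 (z ∘ pairSwap s), ghostWeight S ≤
      2 ^ Fintype.card ι * (traces 𝓑 z).card := by
  have h : ∀ s : ι → Bool, ∑ S ∈ traces 𝓑 (z ∘ pairSwap s), ghostWeight S =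
      ∑ S ∈ traces 𝓑 z, ghostWeight ((pairSwap s).finsetCongr S) := by
    intro s
    have hinv : ∀ S, (pairSwap s).finsetCongr ((pairSwap s).finsetCongr S) = S := by
      intro S
      ext q
      rw [mem_finsetCongr_pairSwap, mem_finsetCongr_pairSwap]
      exact iff_of_eq (congrArg (· ∈ S) ((pairSwap s).left_inv q))
    refine Finset.sum_equiv (pairSwap s).finsetCongr (fun S => mem_traces_comp_pairSwap s) ?_
    intro S _
    rw [hinv]
  simp_rw [h]
  rw [Finset.sum_comm, mul_comm, ← nsmul_eq_mul]
  exact Finset.sum_le_card_nsmul _ _ _ fun S _ => sum_ghostWeight_pairSwap_le S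

end Traces

/-! ### Symmetrization with a second sample -/

section GhostSample

variable {B ι : Type*} [MeasurableSpace B]

/-- A sequence of pairs as a sequence indexed by pairs of an index and a side. -/
def unpairSeq (p : ι → B × B) (q : ι × Bool) : B :=
  if q.2 then (p q.1).2 else (p q.1).1

/-- The total ghost weight of the traces of a family on a double sample. -/
noncomputable def ghostSum [Fintype ι] [DecidableEq ι] (𝓑 : Set (Set B)) (p : ι → B × B) : ℝ≥0∞ :=
  ∑ S ∈ traces 𝓑 (unpairSeq p), ghostWeight S

lemma measurable_unpairSeq (q : ι × Bool) : Measurable fun p : ι → B × B => unpairSeq p q := by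
  unfold unpairSeq
  split_ifs <;> fun_prop

lemma measurable_ghostSum [Fintype ι] [DecidableEq ι] {𝓑 : Set (Set B)}
    (hc : 𝓑.Countable) (hm : ∀ T ∈ 𝓑, MeasurableSet T) :
    Measurable (ghostSum 𝓑 : (ι → B × B) → ℝ≥0∞) := by
  classical
  have h : (ghostSum 𝓑 : (ι → B × B) → ℝ≥0∞) = fun p => ∑ S : Finset (ι × Bool),
      if S ∈ traces 𝓑 (unpairSeq p) then ghostWeight S else 0 := by
    ext p
    simp [ghostSum, Finset.sum_ite_mem]
  rw [h]
  refine Finset.measurable_sum _ fun S _ => Measurable.ite ?_ measurable_const measurable_const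
  have hset : {p : ι → B × B | S ∈ traces 𝓑 (unpairSeq p)} =
      ⋃ T ∈ 𝓑, ⋂ q, {p | q ∈ S ↔ unpairSeq p q ∈ T} := by
    ext p
    simp [mem_traces]
  rw [hset]
  refine MeasurableSet.biUnion hc fun T hT => MeasurableSet.iInter fun q => ?_
  have hq : MeasurableSet {p : ι → B × B | unpairSeq p q ∈ T} := measurable_unpairSeq q (hm T hT)
  by_cases hqS : q ∈ S
  · simpa [hqS] using hq
  · simp only [hqS, false_iff]
    exact hq.compl

/-- Independently exchanging the components of the pairs bounds the mean ghost weight. -/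
lemma lintegral_ghostSum_le [Fintype ι] [DecidableEq ι] (μ : Measure B)
    [IsProbabilityMeasure μ] {𝓑 : Set (Set B)} (hc : 𝓑.Countable) (hm : ∀ T ∈ 𝓑, MeasurableSet T) {C : ℕ}
    (hC : ∀ z : ι × Bool → B, (traces 𝓑 z).card ≤ C) :
    ∫⁻ p, ghostSum 𝓑 p ∂Measure.pi (fun _ : ι => μ.prod μ) ≤ C := by
  have hF := measurable_ghostSum (ι := ι) hc hm
  let e : (ι → Bool) → (ι → B × B) → ι → B × B := fun s p i => if s i then (p i).swap else p i
  have hmp : ∀ s, MeasurePreserving (e s) (Measure.pi fun _ : ι => μ.prod μ)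
      (Measure.pi fun _ : ι => μ.prod μ) := by
    intro s
    refine measurePreserving_pi (fun _ : ι => μ.prod μ) (fun _ : ι => μ.prod μ)
      (f := fun i q => if s i then q.swap else q) fun i => ?_
    cases s i
    · simpa [Function.id_def] using MeasurePreserving.id (μ.prod μ)
    · simpa using Measure.measurePreserving_swap
  have hunpair : ∀ s p, unpairSeq (e s p) = unpairSeq p ∘ pairSwap s := by
    intro s p
    ext ⟨i, b⟩
    cases hs : s i <;> cases b <;> simp [unpairSeq, e, pairSwap, hs]
  have hswap : ∀ s, ∫⁻ p, ghostSum 𝓑 (e s p) ∂Measure.pi (fun _ : ι => μ.prod μ) =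
      ∫⁻ p, ghostSum 𝓑 p ∂Measure.pi (fun _ : ι => μ.prod μ) :=
    fun s => (hmp s).lintegral_comp hF
  have hmul : 2 ^ Fintype.card ι * ∫⁻ p, ghostSum 𝓑 p ∂Measure.pi (fun _ : ι => μ.prod μ) ≤
      2 ^ Fintype.card ι * (C : ℝ≥0∞) := by
    calc 2 ^ Fintype.card ι * ∫⁻ p, ghostSum 𝓑 p ∂Measure.pi (fun _ : ι => μ.prod μ)
        = ∑ s : ι → Bool, ∫⁻ p, ghostSum 𝓑 (e s p) ∂Measure.pi (fun _ : ι => μ.prod μ) := by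
          simp [hswap]
      _ = ∫⁻ p, ∑ s : ι → Bool, ghostSum 𝓑 (e s p) ∂Measure.pi (fun _ : ι => μ.prod μ) :=
          (lintegral_finsetSum _ fun s _ => hF.comp (hmp s).measurable).symm
      _ ≤ ∫⁻ _, 2 ^ Fintype.card ι * (C : ℝ≥0∞) ∂Measure.pi (fun _ : ι => μ.prod μ) := by
          refine lintegral_mono fun p => ?_
          simp only [ghostSum, hunpair]
          refine (sum_ghostWeight_traces_pairSwap_le 𝓑 (unpairSeq p)).trans ?_
          gcongr
          exact hC _
      _ = 2 ^ Fintype.card ι * (C : ℝ≥0∞) := by simp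
  exact (ENNReal.mul_le_mul_iff_right (by simp) (by simp)).1 hmul

/-- By independence the left side is the mean of `2 ^ #{i | y i ∈ T}`. As `T` misses `x`, this is
the weight of the trace of `T`, a single term of the ghost sum. -/
lemma one_add_measure_pow_le_lintegral_ghostSum [Fintype ι] [DecidableEq ι] (μ : Measure B)
    [IsProbabilityMeasure μ] {𝓑 : Set (Set B)} {T : Set B} (hT : T ∈ 𝓑) (hm : MeasurableSet T) {x : ι → B}
    (hx : T ∩ Set.range x = ∅) :
    (1 + μ T) ^ Fintype.card ι ≤
      ∫⁻ y, ghostSum 𝓑 (fun i => (x i, y i)) ∂Measure.pi (fun _ : ι => μ) := by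
  classical
  let f : B → ℝ≥0∞ := fun b => if b ∈ T then 2 else 1
  have hf : Measurable f := Measurable.ite hm measurable_const measurable_const
  have hint : ∫⁻ b, f b ∂μ = 1 + μ T := by
    have : f = fun b => 1 + T.indicator 1 b := by
      ext b
      by_cases hb : b ∈ T <;> simp [f, hb, one_add_one_eq_two]
    rw [this, lintegral_add_left measurable_const, lintegral_indicator_one hm]
    simp
  have hprod : ∫⁻ y, ∏ i, f (y i) ∂Measure.pi (fun _ : ι => μ) = (1 + μ T) ^ Fintype.card ι := by
    rw [lintegral_prod_eq_prod_lintegral_of_indepFun Finset.univ (fun i (y : ι → B) => f (y i))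
      (iIndepFun_pi (μ := fun _ : ι => μ) (X := fun _ => f) fun _ => hf.aemeasurable)
      (fun i => by fun_prop)]
    have : ∀ i, ∫⁻ y : ι → B, f (y i) ∂Measure.pi (fun _ : ι => μ) = 1 + μ T := by
      intro i
      rw [← hint]
      exact (measurePreserving_eval (fun _ : ι => μ) i).lintegral_comp hf
    simp [this]
  rw [← hprod]
  refine lintegral_mono fun y => ?_
  have hxT : ∀ i, x i ∉ T := fun i hi => by
    have : x i ∈ T ∩ Set.range x := ⟨hi, i, rfl⟩
    simp [hx] at this
  let S : Finset (ι × Bool) := {q | unpairSeq (fun i => (x i, y i)) q ∈ T}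
  have hS : S ∈ traces 𝓑 (unpairSeq fun i => (x i, y i)) :=
    mem_traces.2 ⟨T, hT, fun q => by simp [S]⟩
  have hw : ghostWeight S = ∏ i, f (y i) := by
    simp [ghostWeight, S, unpairSeq, hxT, f]
  calc ∏ i, f (y i) = ghostWeight S := hw.symm
    _ ≤ ghostSum 𝓑 (fun i => (x i, y i)) :=
      Finset.single_le_sum (f := fun S => ghostWeight S) (fun _ _ => zero_le) hS

end GhostSample

/-! ### Exponential moment of the dispersion -/

section Dispersion

variable {B : Type*} [MeasurableSpace B]

lemma dispersion_nonneg (μ : Measure B) (𝓑 : Set (Set B)) (P : Set B) :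
    0 ≤ dispersion μ 𝓑 P :=
  Real.sSup_nonneg (by rintro r ⟨T, -, -, rfl⟩; exact measureReal_nonneg)

lemma dispersion_le_one (μ : Measure B) [IsProbabilityMeasure μ] (𝓑 : Set (Set B)) (P : Set B) :
    dispersion μ 𝓑 P ≤ 1 :=
  Real.sSup_le (by rintro r ⟨T, -, -, rfl⟩; exact measureReal_le_one) zero_le_one

lemma measurable_dispersion_range (μ : Measure B) [IsProbabilityMeasure μ] {𝓑 : Set (Set B)}
    (hc : 𝓑.Countable) (hm : ∀ T ∈ 𝓑, MeasurableSet T) {ι : Type*} [Countable ι] :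
    Measurable fun x : ι → B => dispersion μ 𝓑 (Set.range x) := by
  classical
  -- The index set no longer depends on `x`: test sets hit by the sample contribute 0, harmless for
  -- a nonnegative supremum.
  have h : (fun x : ι → B => dispersion μ 𝓑 (Set.range x)) =
      fun x => ⨆ T : 𝓑, if ∀ i, x i ∉ (T : Set B) then μ.real T else 0 := by
    ext x
    have hiff : ∀ T : Set B, T ∩ Set.range x = ∅ ↔ ∀ i, x i ∉ T := by
      intro T
      rw [← Set.disjoint_iff_inter_eq_empty, Set.disjoint_right, Set.forall_mem_range]
    refine le_antisymm (Real.sSup_le ?_ ?_) (Real.iSup_le ?_ (dispersion_nonneg _ _ _))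
    · rintro r ⟨T, hT, hTx, rfl⟩
      have hb : BddAbove (Set.range fun T : 𝓑 =>
          if ∀ i, x i ∉ (T : Set B) then μ.real T else 0) := by
        refine ⟨1, ?_⟩
        rintro _ ⟨T, rfl⟩
        dsimp only
        split_ifs
        exacts [measureReal_le_one, zero_le_one]
      have := le_ciSup hb ⟨T, hT⟩
      rwa [if_pos ((hiff T).1 hTx)] at this
    · refine Real.iSup_nonneg fun T => ?_
      split_ifs
      exacts [measureReal_nonneg, le_rfl]
    · rintro ⟨T, hT⟩
      split_ifs with hTx
      · refine le_csSup ⟨1, ?_⟩ ⟨T, hT, (hiff T).2 hTx, rfl⟩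
        rintro r ⟨T, -, -, rfl⟩
        exact measureReal_le_one
      · exact dispersion_nonneg _ _ _
  rw [h]
  have := hc.to_subtype
  refine Measurable.iSup fun T => Measurable.ite ?_ measurable_const measurable_const
  have hset : {x : ι → B | ∀ i, x i ∉ (T : Set B)} = ⋂ i, {x | x i ∈ (T : Set B)}ᶜ := by
    ext x
    simp
  rw [hset]
  exact MeasurableSet.iInter fun i => (measurable_pi_apply i (hm T T.2)).compl

/-- The summand 1 covers samples that meet every test set: the dispersion is then 0, but the ghost
sum may vanish. -/
lemma two_rpow_dispersion_le (μ : Measure B) [IsProbabilityMeasure μ] {𝓑 : Set (Set B)}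
    (hm : ∀ T ∈ 𝓑, MeasurableSet T) {ι : Type*} [Fintype ι] [DecidableEq ι] [Nonempty ι]
    (x : ι → B) :
    ENNReal.ofReal (2 ^ (Fintype.card ι * dispersion μ 𝓑 (Set.range x))) ≤
      1 + ∫⁻ y, ghostSum 𝓑 (fun i => (x i, y i)) ∂Measure.pi (fun _ : ι => μ) := by
  set G : ℝ≥0∞ := 1 + ∫⁻ y, ghostSum 𝓑 (fun i => (x i, y i)) ∂Measure.pi (fun _ : ι => μ) with hG
  have hn : (0 : ℝ) < Fintype.card ι := by exact_mod_cast Fintype.card_pos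
  by_cases htop : G = ∞
  · simp [htop]
  have hg1 : 1 ≤ G.toReal := by
    have : (1 : ℝ≥0∞) ≤ G := le_self_add
    simpa using ENNReal.toReal_mono htop this
  have hg0 : 0 < G.toReal := by linarith
  have hD : dispersion μ 𝓑 (Set.range x) ≤ Real.logb 2 G.toReal / Fintype.card ι := by
    refine Real.sSup_le ?_ (div_nonneg (Real.logb_nonneg one_lt_two hg1) hn.le)
    rintro r ⟨T, hT, hTx, rfl⟩
    rw [le_div_iff₀' hn, Real.le_logb_iff_rpow_le one_lt_two hg0]
    -- Bernoulli's inequality for an exponent in `[0, 1]`.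
    have h1 : (2 : ℝ) ^ μ.real T ≤ 1 + μ.real T := by
      have := rpow_one_add_le_one_add_mul_self (s := 1) (by norm_num)
        (measureReal_nonneg (μ := μ) (s := T)) measureReal_le_one
      rwa [one_add_one_eq_two, mul_one] at this
    have h2 : (1 + μ.real T) ^ Fintype.card ι ≤ G.toReal := by
      have h3 : (1 + μ T) ^ Fintype.card ι ≤ G :=
        (one_add_measure_pow_le_lintegral_ghostSum μ hT (hm T hT) hTx).trans le_add_self
      have h4 := ENNReal.toReal_mono htop h3
      rwa [ENNReal.toReal_pow, ENNReal.toReal_add ENNReal.one_ne_top (measure_ne_top μ T),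
        ENNReal.toReal_one] at h4
    calc (2 : ℝ) ^ (Fintype.card ι * μ.real T) = (2 ^ μ.real T) ^ Fintype.card ι := by
          rw [mul_comm, Real.rpow_mul zero_le_two, Real.rpow_natCast]
      _ ≤ (1 + μ.real T) ^ Fintype.card ι := by gcongr
      _ ≤ G.toReal := h2
  refine ENNReal.ofReal_le_of_le_toReal ?_
  rwa [← Real.le_logb_iff_rpow_le one_lt_two hg0, ← le_div_iff₀' hn]

lemma lintegral_two_rpow_dispersion_le (μ : Measure B) [IsProbabilityMeasure μ]
    {𝓑 : Set (Set B)} (hc : 𝓑.Countable) (hm : ∀ T ∈ 𝓑, MeasurableSet T)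
    {ι : Type*} [Fintype ι] [DecidableEq ι] [Nonempty ι] {C : ℕ}
    (hC : ∀ z : ι × Bool → B, (traces 𝓑 z).card ≤ C) :
    ∫⁻ x, ENNReal.ofReal (2 ^ (Fintype.card ι * dispersion μ 𝓑 (Set.range x)))
      ∂Measure.pi (fun _ : ι => μ) ≤ 1 + C := by
  have hF := measurable_ghostSum (ι := ι) hc hm
  have hpair : Measurable fun q : (ι → B) × (ι → B) => ghostSum 𝓑 fun i => (q.1 i, q.2 i) :=
    hF.comp (by fun_prop)
  have hmp := (measurePreserving_arrowProdEquivProdArrow B B ι (fun _ => μ) (fun _ => μ))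
  calc _ ≤ ∫⁻ x, (1 + ∫⁻ y, ghostSum 𝓑 (fun i => (x i, y i)) ∂Measure.pi (fun _ : ι => μ))
        ∂Measure.pi (fun _ : ι => μ) := lintegral_mono fun x => two_rpow_dispersion_le μ hm x
    _ = 1 + ∫⁻ q, ghostSum 𝓑 (fun i => (q.1 i, q.2 i))
        ∂(Measure.pi (fun _ : ι => μ)).prod (Measure.pi (fun _ : ι => μ)) := by
      rw [lintegral_add_left measurable_const, lintegral_prod _ hpair.aemeasurable]
      simp
    _ = 1 + ∫⁻ p, ghostSum 𝓑 p ∂Measure.pi (fun _ : ι => μ.prod μ) := by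
      rw [← hmp.lintegral_comp hpair]
      rfl
    _ ≤ 1 + C := by
      gcongr
      exact lintegral_ghostSum_le μ hc hm hC

/-- Jensen's inequality for the exponential function with base `2`, with a bound on the mean. -/
lemma integral_le_logb_of_lintegral_two_rpow_le {Ω : Type*} [MeasurableSpace Ω] {P : Measure Ω}
    [IsProbabilityMeasure P] {f : Ω → ℝ} (hf : Integrable f P) {A : ℝ} (hA : 0 < A)
    (h : ∫⁻ ω, ENNReal.ofReal (2 ^ f ω) ∂P ≤ ENNReal.ofReal A) :
    ∫ ω, f ω ∂P ≤ Real.logb 2 A := by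
  have hmeas : AEStronglyMeasurable (fun ω => (2 : ℝ) ^ f ω) P :=
    (hf.aemeasurable.const_pow (2 : ℝ)).aestronglyMeasurable
  have hpos : 0 ≤ᵐ[P] fun ω => (2 : ℝ) ^ f ω := ae_of_all _ fun ω => by positivity
  have hint : Integrable (fun ω => (2 : ℝ) ^ f ω) P :=
    (lintegral_ofReal_ne_top_iff_integrable hmeas hpos).1
      (ne_top_of_le_ne_top ENNReal.ofReal_ne_top h)
  have hle : ∫ ω, (2 : ℝ) ^ f ω ∂P ≤ A := by
    rw [integral_eq_lintegral_of_nonneg_ae hpos hmeas]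
    exact ENNReal.toReal_le_of_le_ofReal hA.le h
  -- Integrating `log u ≤ u - 1` at `u = 2 ^ f ω / A` is all that is needed of Jensen.
  have hpt : ∀ ω, Real.log 2 * f ω ≤ 2 ^ f ω / A - 1 + Real.log A := by
    intro ω
    have h2 : (0 : ℝ) < 2 ^ f ω := by positivity
    have := Real.log_le_sub_one_of_pos (div_pos h2 hA)
    rw [Real.log_div h2.ne' hA.ne', Real.log_rpow two_pos] at this
    linarith
  have hsub : Integrable (fun ω => 2 ^ f ω / A - 1) P :=
    (hint.div_const A).sub (integrable_const 1)
  have hI := integral_mono (hf.const_mul (Real.log 2))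
    (hsub.add (integrable_const (Real.log A))) hpt
  have hE : ∫ ω, (2 ^ f ω / A - 1 + Real.log A) ∂P =
      (∫ ω, (2 : ℝ) ^ f ω ∂P) / A - 1 + Real.log A := by
    rw [integral_add hsub (integrable_const _),
      integral_sub (hint.div_const A) (integrable_const 1), integral_div]
    simp
  rw [integral_const_mul] at hI
  have hI' : Real.log 2 * ∫ ω, f ω ∂P ≤ (∫ ω, (2 : ℝ) ^ f ω ∂P) / A - 1 + Real.log A :=
    hI.trans hE.le
  have hdiv : (∫ ω, (2 : ℝ) ^ f ω ∂P) / A ≤ 1 := (div_le_one hA).2 hle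
  rw [Real.logb, le_div_iff₀' (Real.log_pos one_lt_two)]
  linarith

end Dispersion

/-! ### The expected dispersion -/

theorem mainTheorem3 {B Ω : Type*} [MeasurableSpace B] [MeasurableSpace Ω]
    (μ : Measure B) [IsProbabilityMeasure μ]
    (𝓑 : Set (Set B)) (h𝓑_countable : 𝓑.Countable) (h𝓑_meas : ∀ T ∈ 𝓑, MeasurableSet T)
    (d : ℕ) (hd : setVCDim 𝓑 = d) (hd_pos : 1 ≤ d)
    (Pr : Measure Ω) [IsProbabilityMeasure Pr]
    (n : ℕ) (hn : d ≤ n)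
    (X : Fin n → Ω → B) (hX_indep : iIndepFun X Pr) (hX_law : ∀ i, HasLaw (X i) μ Pr) :
    Integrable (fun ω => dispersion μ 𝓑 (Set.range fun i => X i ω)) Pr ∧
      ∫ ω, dispersion μ 𝓑 (Set.range fun i => X i ω) ∂Pr ≤
        4 * (d : ℝ) / n * Real.logb 2 (Real.exp 1 * n / d) := by
  have hlaw := hX_indep.hasLaw_pi hX_law
  have hDm := measurable_dispersion_range μ h𝓑_countable h𝓑_meas (ι := Fin n)
  have hint : Integrable (fun x : Fin n → B => dispersion μ 𝓑 (Set.range x))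
      (Measure.pi fun _ : Fin n => μ) := by
    refine Integrable.of_bound hDm.aestronglyMeasurable 1 (ae_of_all _ fun x => ?_)
    rw [Real.norm_of_nonneg (dispersion_nonneg _ _ _)]
    exact dispersion_le_one _ _ _
  have hintX : Integrable (fun ω => dispersion μ 𝓑 (Set.range fun i => X i ω)) Pr := by
    rw [← hlaw.map_eq] at hint
    exact hint.comp_aemeasurable hlaw.aemeasurable
  refine ⟨hintX, ?_⟩
  have heq : ∫ ω, dispersion μ 𝓑 (Set.range fun i => X i ω) ∂Pr =
      ∫ x : Fin n → B, dispersion μ 𝓑 (Set.range x) ∂Measure.pi fun _ : Fin n => μ :=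
    hlaw.integral_comp hDm.aestronglyMeasurable
  rw [heq]
  have hd0 : (1 : ℝ) ≤ d := by exact_mod_cast hd_pos
  have hn0 : (0 : ℝ) < n := by exact_mod_cast lt_of_lt_of_le hd_pos hn
  have : NeZero n := ⟨by omega⟩
  set q : ℝ := Real.exp 1 * n / d with hq
  have hq2 : 2 ≤ q := by
    rw [hq, le_div_iff₀ (by linarith)]
    have h1 : (2 : ℝ) ≤ Real.exp 1 := by linarith [Real.add_one_le_exp (1 : ℝ)]
    have h2 : (d : ℝ) ≤ n := by exact_mod_cast hn
    nlinarith
  set C : ℕ := ∑ k ∈ Finset.Iic d, (2 * n).choose k with hC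
  have hCq : (C : ℝ) ≤ (2 * q) ^ d := by
    have := sum_choose_le_exp_mul_div_pow hd_pos (show d ≤ 2 * n by omega)
    refine this.trans_eq ?_
    rw [hq]
    push_cast
    ring
  -- The summand 1 costs a factor `2 ≤ 2 ^ d`, absorbed into the base.
  have hA : 1 + (C : ℝ) ≤ (4 * q) ^ d := by
    have h1 : (1 : ℝ) ≤ (2 * q) ^ d := one_le_pow₀ (by linarith)
    have h2 : (2 : ℝ) ≤ 2 ^ d := le_self_pow₀ one_le_two (by omega)
    calc 1 + (C : ℝ) ≤ 2 * (2 * q) ^ d := by linarith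
      _ ≤ 2 ^ d * (2 * q) ^ d := by gcongr
      _ = (4 * q) ^ d := by rw [← mul_pow]; ring
  have hmean : ∫ x : Fin n → B, n * dispersion μ 𝓑 (Set.range x) ∂Measure.pi (fun _ : Fin n => μ) ≤
      Real.logb 2 ((4 * q) ^ d) := by
    refine integral_le_logb_of_lintegral_two_rpow_le (hint.const_mul _) (by positivity) ?_
    have h := lintegral_two_rpow_dispersion_le μ h𝓑_countable h𝓑_meas (ι := Fin n) (C := C)
      fun z => by
        have := card_traces_le hd.le z
        rwa [Fintype.card_prod, Fintype.card_fin, Fintype.card_bool, mul_comm] at this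
    rw [Fintype.card_fin] at h
    refine h.trans ?_
    rw [← ENNReal.ofReal_natCast, ← ENNReal.ofReal_one, ← ENNReal.ofReal_add zero_le_one (by simp)]
    exact ENNReal.ofReal_le_ofReal hA
  rw [integral_const_mul, Real.logb_pow, Real.logb_mul (by norm_num) (by linarith)] at hmean
  have h4 : Real.logb 2 4 = 2 := by
    rw [show (4 : ℝ) = 2 ^ (2 : ℝ) by norm_num, Real.logb_rpow] <;> norm_num
  have hL : 1 ≤ Real.logb 2 q := by
    rw [Real.le_logb_iff_rpow_le one_lt_two (by linarith)]
    simpa using hq2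
  rw [h4] at hmean
  -- `logb 2 q ≥ 1` gives `2 + logb 2 q ≤ 3 * logb 2 q`, within the constant 4.
  rw [div_mul_eq_mul_div, le_div_iff₀' hn0]
  nlinarith
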